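/- Let $\mathbb N=\{1,2,3,\dots\}$, let $d\ge 3$ be an integer and let $\psi:\mathbb N\to[0,\infty)$ be non-increasing. Let $\mathcal W_d(\psi)$ be the set of all $\boldsymbol z\in\mathbb R^d$ for which the inequality $\|q\boldsymbol z-\boldsymbol p\|_\infty<\psi(q)$ holds for infinitely many $(\boldsymbol p,q)\in\mathbb Z^d\times\mathbb N$. Suppose that every set $A\subseteq\mathbb N$ for which the series $\sum_{q\in A}\psi(q)^d$ converges has asymptotic density zero, that is, $\lim_{N\to\infty}|A\cap[1,N]|/N=0$. Then for every $x\in\mathbb R$ the set $\mathcal W_d(\psi)\cap(\{x\}\times\mathbb R^{d-1})$ has full $(d-1)$-dimensional Lebesgue measure in the fiber $\{x\}\times\mathbb R^{d-1}$; that is, for Lebesgue-almost every $\boldsymbol y\in\mathbb R^{d-1}$ we have $(x,\boldsymbol y)\in\mathcal W_d(\psi)$. -/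

import Mathlib

open Filter Topology MeasureTheory

/-- `ψ`, restricted to the positive integers, is an approximating function: it takes nonnegative
values there and is non-increasing. (The value `ψ 0` is never used.) -/
def IsApproximating (ψ : ℕ → ℝ) : Prop :=
  (∀ q : ℕ, 1 ≤ q → 0 ≤ ψ q) ∧ AntitoneOn ψ (Set.Ici 1)

/-- The set of `ψ`-approximable vectors in `ℝ^d`. The norm on `Fin d → ℝ` is the sup norm. -/
def approximable (d : ℕ) (ψ : ℕ → ℝ) : Set (Fin d → ℝ) :=
  {z | {pq : (Fin d → ℤ) × ℕ |
      1 ≤ pq.2 ∧ ‖(pq.2 : ℝ) • z - (fun i => (pq.1 i : ℝ))‖ < ψ pq.2}.Infinite}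

/-- The set `A` of positive integers has asymptotic density `δ`. -/
def HasDensity (A : Set ℕ) (δ : ℝ) : Prop :=
  Tendsto (fun N : ℕ => ((A ∩ Set.Icc 1 N).ncard : ℝ) / (N : ℝ)) atTop (𝓝 δ)

/-- The point `(x, y_1, …, y_{d-1})` of the fiber `{x} × ℝ^{d-1}` in `ℝ^d`. -/
def fiberPoint {d : ℕ} (x : ℝ) (y : Fin (d - 1) → ℝ) : Fin d → ℝ :=
  fun i => if h : (i : ℕ) = 0 then x else y ⟨(i : ℕ) - 1, by have := i.isLt; omega⟩

/-! The density hypothesis forces `q ψ(q)^d ≥ c > 0` for large `q`: otherwise sparse dyadic blocks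
give a convergent series over a set of positive upper density. Dirichlet's theorem then approximates
every `(x, y)`, and weighting it puts the whole loss on `y`: the error is below `ψ q` in `x` and
below `k ψ q` in the other coordinates. On the fiber, keep only those `q` with `|q x - a| < ψ q` for
some integer `a`. By Cassels' lemma (`blimsup_thickening_mul_ae_eq`), dividing all radii by `k`
changes the limsup set in `y` by a null set only, so the factor `k` disappears for almost every `y`.
-/

/-- Weighted Dirichlet theorem: simultaneous approximation with one denominator and
prescribed precision in every coordinate. -/
theorem exists_simultaneous_approx {ι : Type*} [Fintype ι] (z : ι → ℝ) (K : ι → ℕ)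
    (hK : ∀ i, 0 < K i) :
    ∃ q : ℕ, 1 ≤ q ∧ q ≤ ∏ i, K i ∧ ∃ p : ι → ℤ, ∀ i, |(q : ℝ) * z i - p i| < 1 / (K i : ℝ) := by
  classical
  have hKr : ∀ i, (0 : ℝ) < K i := fun i => by exact_mod_cast hK i
  have hcell : ∀ (t : ℕ) (i : ι), ⌊(K i : ℝ) * Int.fract ((t : ℝ) * z i)⌋₊ < K i := by
    intro t i
    rw [Nat.floor_lt (mul_nonneg (hKr i).le (Int.fract_nonneg _))]
    exact mul_lt_of_lt_one_right (hKr i) (Int.fract_lt_one _)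
  -- Pigeonhole: `∏ K i + 1` multiples of `z` modulo 1 fall into `∏ K i` boxes with sides `1 / K i`.
  let cell : Fin ((∏ i, K i) + 1) → ∀ i, Fin (K i) := fun t i => ⟨_, hcell t i⟩
  obtain ⟨a, b, hab, hcab⟩ : ∃ a b, a < b ∧ cell a = cell b := by
    obtain ⟨a, b, hne, h⟩ := Fintype.exists_ne_map_eq_of_card_lt cell (by simp)
    rcases lt_or_gt_of_ne hne with hlt | hlt
    · exact ⟨a, b, hlt, h⟩
    · exact ⟨b, a, hlt, h.symm⟩
  have hab' : (a : ℕ) < b := hab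
  refine ⟨b - a, by omega, by omega, fun i => ⌊((b : ℕ) : ℝ) * z i⌋ - ⌊((a : ℕ) : ℝ) * z i⌋,
    fun i => ?_⟩
  have hfl : ⌊(K i : ℝ) * Int.fract (((a : ℕ) : ℝ) * z i)⌋₊
      = ⌊(K i : ℝ) * Int.fract (((b : ℕ) : ℝ) * z i)⌋₊ := congrArg Fin.val (congrFun hcab i)
  have ha := mul_nonneg (hKr i).le (Int.fract_nonneg (((a : ℕ) : ℝ) * z i))
  have hb := mul_nonneg (hKr i).le (Int.fract_nonneg (((b : ℕ) : ℝ) * z i))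
  have ha1 := Nat.floor_le ha
  have ha2 := Nat.lt_floor_add_one ((K i : ℝ) * Int.fract (((a : ℕ) : ℝ) * z i))
  have hb1 := Nat.floor_le hb
  have hb2 := Nat.lt_floor_add_one ((K i : ℝ) * Int.fract (((b : ℕ) : ℝ) * z i))
  rw [hfl] at ha1 ha2
  have heq : (((b : ℕ) - (a : ℕ) : ℕ) : ℝ) * z i
      - ((⌊((b : ℕ) : ℝ) * z i⌋ - ⌊((a : ℕ) : ℝ) * z i⌋ : ℤ) : ℝ)
      = Int.fract (((b : ℕ) : ℝ) * z i) - Int.fract (((a : ℕ) : ℝ) * z i) := by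
    rw [Nat.cast_sub hab'.le, Int.fract, Int.fract]
    push_cast
    ring
  rw [heq, abs_lt, ← neg_div, div_lt_iff₀ (hKr i), lt_div_iff₀ (hKr i)]
  constructor <;> linarith

/-- Up to `2 * N i`, the block alone already gives proportion at least `1/2`. -/
theorem not_hasDensity_zero_of_Ico_subset {A : Set ℕ} {N : ℕ → ℕ} (hN : StrictMono N)
    (hA : ∀ i, Set.Ico (N i) (2 * N i) ⊆ A) : ¬ HasDensity A 0 := by
  intro h
  have hlim : Tendsto (fun i => 2 * N i) atTop atTop :=
    tendsto_atTop_mono (fun i => Nat.le_mul_of_pos_left (N i) two_pos) hN.tendsto_atTop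
  have hlt := ((h.comp hlim).eventually_lt_const (by norm_num : (0 : ℝ) < 1 / 2))
  obtain ⟨i, hi, hi1⟩ := (hlt.and (eventually_ge_atTop 1)).exists
  have hpos : 1 ≤ N i := hi1.trans hN.le_apply
  have hcard : N i ≤ (A ∩ Set.Icc 1 (2 * N i)).ncard := by
    calc N i = (Set.Ico (N i) (2 * N i)).ncard := by
          rw [← Finset.coe_Ico, Set.ncard_coe_finset, Nat.card_Ico]; omega
      _ ≤ _ := Set.ncard_le_ncard (Set.subset_inter (hA i)
          (Set.Ico_subset_Icc_self.trans (Set.Icc_subset_Icc_left hpos)))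
          ((Set.finite_Icc _ _).inter_of_right _)
  have hposr : (0 : ℝ) < N i := by exact_mod_cast hpos
  have hcardr : (N i : ℝ) ≤ (A ∩ Set.Icc 1 (2 * N i)).ncard := by exact_mod_cast hcard
  simp only [Function.comp] at hi
  rw [div_lt_iff₀ (by push_cast; linarith)] at hi
  push_cast at hi
  linarith

/-- If the series `∑ ψ(q)^d` diverges along all sets that do not have density zero, then
`q ψ(q)^d` is bounded away from zero. -/
theorem exists_lower_bound_of_density {d : ℕ} {ψ : ℕ → ℝ} (hψ : IsApproximating ψ)
    (hdens : ∀ A : Set ℕ, A ⊆ Set.Ici 1 →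
      Summable (fun q : A => ψ (q : ℕ) ^ d) → HasDensity A 0) :
    ∃ c : ℝ, 0 < c ∧ ∀ᶠ N : ℕ in atTop, c ≤ N * ψ N ^ d := by
  by_contra hcon
  push Not at hcon
  obtain ⟨N, hN, hNP⟩ := extraction_forall_of_frequently
    (P := fun n k => k * ψ k ^ d < (1 / 2 : ℝ) ^ n ∧ 1 ≤ k)
    (fun n => (hcon ((1 / 2 : ℝ) ^ n) (by positivity)).and_eventually (eventually_ge_atTop 1))
  have hA1 : (⋃ i, Set.Ico (N i) (2 * N i)) ⊆ Set.Ici 1 :=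
    Set.iUnion_subset fun i q hq => (hNP i).2.trans hq.1
  refine not_hasDensity_zero_of_Ico_subset hN (fun i => Set.subset_iUnion_of_subset i subset_rfl)
    (hdens _ hA1 ?_)
  -- By monotonicity a block contributes at most `N i * ψ (N i) ^ d`, so the series is dominated by
  -- a geometric one, even if blocks overlap.
  have hblock : ∀ i, ∑' q : Set.Ico (N i) (2 * N i), ENNReal.ofReal (ψ q ^ d)
      ≤ ENNReal.ofReal ((1 / 2 : ℝ) ^ i) := by
    intro i
    have hfin : ∑' q : Set.Ico (N i) (2 * N i), ENNReal.ofReal (ψ q ^ d)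
        = ∑ q ∈ Finset.Ico (N i) (2 * N i), ENNReal.ofReal (ψ q ^ d) := by
      rw [← Finset.coe_Ico]
      exact Finset.tsum_subtype _ fun q => ENNReal.ofReal (ψ q ^ d)
    rw [hfin]
    calc _ ≤ ∑ q ∈ Finset.Ico (N i) (2 * N i), ENNReal.ofReal (ψ (N i) ^ d) := by
          refine Finset.sum_le_sum fun q hq => ENNReal.ofReal_le_ofReal ?_
          have hq' := (Finset.mem_Ico.1 hq).1
          have h1q := (hNP i).2.trans hq'
          exact pow_le_pow_left₀ (hψ.1 q h1q) (hψ.2 (hNP i).2 h1q hq') d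
      _ = ENNReal.ofReal (N i * ψ (N i) ^ d) := by
          rw [Finset.sum_const, Nat.card_Ico, show 2 * N i - N i = N i by omega, nsmul_eq_mul,
            ENNReal.ofReal_mul (by positivity), ENNReal.ofReal_natCast]
      _ ≤ _ := ENNReal.ofReal_le_ofReal (hNP i).1.le
  have htsum : ∑' q : (⋃ i, Set.Ico (N i) (2 * N i) : Set ℕ), ENNReal.ofReal (ψ q ^ d) ≠ ⊤ := by
    refine ne_top_of_le_ne_top ?_ ((ENNReal.tsum_iUnion_le_tsum
      (fun q => ENNReal.ofReal (ψ q ^ d)) _).trans (ENNReal.tsum_le_tsum hblock))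
    rw [← ENNReal.ofReal_tsum_of_nonneg (fun i => by positivity) summable_geometric_two]
    exact ENNReal.ofReal_ne_top
  refine (ENNReal.summable_toReal htsum).congr fun q => ?_
  exact ENNReal.toReal_ofReal (pow_nonneg (hψ.1 _ (hA1 q.2)) d)

/-- If `q ψ(q)^d` is bounded away from zero, every `z` is approximable with error `ψ(q)` in the
coordinate `i₀` and error `k ψ(q)` in the others, with arbitrarily large denominators. -/
theorem exists_constant_frequently_approx {d : ℕ} (hd : 2 ≤ d) {ψ : ℕ → ℝ}
    (hψ : IsApproximating ψ) {c : ℝ} (hc : 0 < c) (hcψ : ∀ᶠ N : ℕ in atTop, c ≤ N * ψ N ^ d)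
    (i₀ : Fin d) :
    ∃ k : ℝ, 0 < k ∧ ∀ z : Fin d → ℝ, ∃ᶠ q : ℕ in atTop, ∃ p : Fin d → ℤ,
      |(q : ℝ) * z i₀ - p i₀| < ψ q ∧ ∀ i, |(q : ℝ) * z i - p i| < k * ψ q := by
  obtain ⟨k, hk⟩ := exists_nat_gt (max 1 (1 / c))
  have hk1 : (1 : ℝ) < k := (le_max_left _ _).trans_lt hk
  have hkc : 1 / c < k := (le_max_right _ _).trans_lt hk
  have hk0 : (0 : ℝ) < k := by linarith
  have hk0' : 0 < k := by exact_mod_cast hk0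
  -- The weights `k m, m, …, m` have product `k m^d`, where `ψ^d ≥ c / (k m^d)`. This exceeds `1 /
  -- (k m)^d` exactly when `c k^(d-1) > 1`, which follows from `k > max 1 (1/c)` and `d ≥ 2`.
  have hscale : ∀ᶠ m : ℕ in atTop, 1 ≤ m ∧ 1 / ((k * m : ℕ) : ℝ) < ψ (k * m ^ d) := by
    have hlim : Tendsto (fun m : ℕ => k * m ^ d) atTop atTop :=
      tendsto_atTop_mono (fun m => (Nat.le_self_pow (by omega) m).trans
        (Nat.le_mul_of_pos_left _ hk0')) tendsto_id
    filter_upwards [hlim.eventually hcψ, eventually_ge_atTop 1] with m hm hm1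
    have hm0 : (0 : ℝ) < m := by exact_mod_cast hm1
    refine ⟨hm1, lt_of_pow_lt_pow_left₀ d (hψ.1 _ (Nat.mul_pos hk0' (pow_pos hm1 d))) ?_⟩
    have hkd : 1 < c * (k : ℝ) ^ (d - 1) := by
      have h1 : 1 < k * c := (div_lt_iff₀ hc).1 hkc
      have h2 : (k : ℝ) ≤ k ^ (d - 1) := le_self_pow₀ hk1.le (by omega)
      nlinarith
    have hkk : (k : ℝ) ^ d = k ^ (d - 1) * k := by
      rw [← pow_succ, Nat.sub_add_cancel (by omega)]
    push_cast at hm ⊢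
    rw [div_pow, one_pow, mul_pow, div_lt_iff₀ (by positivity), hkk]
    calc (1 : ℝ) < c * k ^ (d - 1) := hkd
      _ ≤ (k * m ^ d * ψ (k * m ^ d) ^ d) * k ^ (d - 1) := by gcongr
      _ = _ := by ring
  have hψpos : ∀ q : ℕ, 1 ≤ q → 0 < ψ q := by
    intro q hq
    obtain ⟨m, ⟨hm1, hm⟩, hmq⟩ := (hscale.and (eventually_ge_atTop q)).exists
    have hle : q ≤ k * m ^ d := hmq.trans ((Nat.le_self_pow (by omega) m).trans
      (Nat.le_mul_of_pos_left _ hk0'))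
    exact (lt_of_le_of_lt (by positivity) hm).trans_le (hψ.2 hq (hq.trans hle) hle)
  refine ⟨k, hk0, fun z => frequently_atTop.2 fun Q => ?_⟩
  -- Dirichlet could return the same `q` forever only if `z` is rational; then multiples of a common
  -- denominator have error zero, and positivity of `ψ` suffices.
  by_cases hz : ∃ q : ℕ, 1 ≤ q ∧ ∃ p : Fin d → ℤ, ∀ i, (q : ℝ) * z i - p i = 0
  · obtain ⟨q, hq, p, hp⟩ := hz
    have hpos : 1 ≤ (Q + 1) * q := Nat.mul_pos Q.succ_pos hq
    have hzero : ∀ i, (((Q + 1) * q : ℕ) : ℝ) * z i - (((Q + 1) * p i : ℤ) : ℝ) = 0 := by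
      intro i
      have := hp i
      push_cast
      linear_combination (Q + 1 : ℝ) * this
    refine ⟨(Q + 1) * q, by nlinarith, fun i => (Q + 1) * p i, ?_, fun i => ?_⟩
    · rw [hzero, abs_zero]; exact hψpos _ hpos
    · rw [hzero, abs_zero]; exact mul_pos hk0 (hψpos _ hpos)
  · push Not at hz
    -- For irrational `z`, the finitely many `q < Q` stay away from error zero, so a large `m`
    -- excludes them.
    have hsmall : ∀ᶠ m : ℕ in atTop, ∀ q ∈ Finset.Ico 1 Q,
        ∃ i, 1 / (m : ℝ) < |(q : ℝ) * z i - round ((q : ℝ) * z i)| := by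
      refine (Filter.eventually_all_finset _).2 fun q hq => ?_
      obtain ⟨i, hi⟩ := hz q (Finset.mem_Ico.1 hq).1 fun i => round ((q : ℝ) * z i)
      filter_upwards [tendsto_one_div_atTop_nhds_zero_nat.eventually_lt_const (abs_pos.2 hi)]
        with m hm using ⟨i, hm⟩
    obtain ⟨m, ⟨hm1, hm⟩, hmQ⟩ := (hscale.and hsmall).exists
    have hm0 : (0 : ℝ) < m := by exact_mod_cast hm1
    obtain ⟨q, hq1, hqN, p, hp⟩ := exists_simultaneous_approx z
      (fun i => if i = i₀ then k * m else m) (fun i => by split_ifs <;> positivity)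
    have hN : ∏ i, (if i = i₀ then k * m else m) = k * m ^ d := by
      have hsplit : ∀ i, (if i = i₀ then k * m else m) = (if i = i₀ then k else 1) * m := by
        intro i; split_ifs <;> simp
      simp only [hsplit, Finset.prod_mul_distrib]
      simp
    rw [hN] at hqN
    have hψq : 1 / ((k * m : ℕ) : ℝ) < ψ q := hm.trans_le (hψ.2 hq1 (hq1.trans hqN) hqN)
    have hkm : 1 / (m : ℝ) < k * ψ q := by
      calc 1 / (m : ℝ) = k * (1 / ((k * m : ℕ) : ℝ)) := by push_cast; field_simp
        _ < _ := by gcongr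
    have hpm : ∀ i, |(q : ℝ) * z i - p i| < 1 / (m : ℝ) := by
      intro i
      refine (hp i).trans_le ?_
      split_ifs
      · gcongr
        exact Nat.le_mul_of_pos_left _ hk0'
      · exact le_rfl
    refine ⟨q, ?_, p, ?_, fun i => (hpm i).trans hkm⟩
    · by_contra hlt
      obtain ⟨i, hi⟩ := hmQ q (Finset.mem_Ico.2 ⟨hq1, by omega⟩)
      exact absurd (hi.trans_le (round_le _ (p i))) (hpm i).not_gt
    · have := hp i₀
      simp only [if_true] at this
      exact this.trans hψq

/-- The points of `ℝ^ι` with rational coordinates of common denominator `q`. -/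
def rationalPoints (ι : Type*) (q : ℕ) : Set (ι → ℝ) :=
  Set.range fun (p : ι → ℤ) i => (p i : ℝ) / q

theorem mem_thickening_rationalPoints {ι : Type*} [Fintype ι] {q : ℕ} (hq : 1 ≤ q) {r : ℝ}
    (hr : 0 < r) {y : ι → ℝ} :
    y ∈ Metric.thickening (r / q) (rationalPoints ι q) ↔
      ∃ p : ι → ℤ, ∀ i, |(q : ℝ) * y i - p i| < r := by
  have hq0 : (0 : ℝ) < q := by exact_mod_cast hq
  simp only [Metric.mem_thickening_iff, rationalPoints, Set.exists_range_iff,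
    dist_pi_lt_iff (div_pos hr hq0), Real.dist_eq]
  refine exists_congr fun p => forall_congr' fun i => ?_
  rw [lt_div_iff₀ hq0, ← abs_of_pos hq0, ← abs_mul, abs_of_pos hq0]
  congr! 2
  field_simp

theorem mem_blimsup_atTop_iff {α : Type*} {p : ℕ → Prop} {s : ℕ → Set α} {a : α} :
    a ∈ blimsup s atTop p ↔ ∃ᶠ n in atTop, p n ∧ a ∈ s n := by
  rw [← Nat.cofinite_eq_atTop, cofinite.blimsup_set_eq, frequently_cofinite_iff_infinite]
  rfl

theorem theorem4 (d : ℕ) (hd : 3 ≤ d) (ψ : ℕ → ℝ) (hψ : IsApproximating ψ)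
    (hdens : ∀ A : Set ℕ, A ⊆ Set.Ici 1 →
      Summable (fun q : A => ψ (q : ℕ) ^ d) → HasDensity A 0) (x : ℝ) :
    volume ({y : Fin (d - 1) → ℝ | fiberPoint x y ∈ approximable d ψ}ᶜ) = 0 := by
  obtain ⟨n, rfl⟩ : ∃ n, d = n + 1 := ⟨d - 1, by omega⟩
  change volume ({y : Fin n → ℝ | fiberPoint (d := n + 1) x y ∈ approximable (n + 1) ψ}ᶜ) = 0
  have hzero : ∀ y : Fin n → ℝ, fiberPoint (d := n + 1) x y 0 = x := fun y => by simp [fiberPoint]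
  have hsucc : ∀ (y : Fin n → ℝ) (i : Fin n), fiberPoint (d := n + 1) x y i.succ = y i :=
    fun y i => by simp [fiberPoint]
  obtain ⟨c, hc, hcψ⟩ := exists_lower_bound_of_density hψ hdens
  obtain ⟨k, hk, happ⟩ := exists_constant_frequently_approx (by omega) hψ hc hcψ 0
  have hr : Tendsto (fun q : ℕ => ψ q / q) atTop (𝓝 0) := by
    refine squeeze_zero' ?_ ?_ (tendsto_const_div_atTop_nhds_zero_nat (ψ 1))
    · filter_upwards [eventually_ge_atTop 1] with q hq using div_nonneg (hψ.1 q hq) q.cast_nonneg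
    · filter_upwards [eventually_ge_atTop 1] with q hq
      have := hψ.2 (Set.mem_Ici.2 le_rfl) hq hq
      gcongr
  -- The condition on `q` does not involve `y`, so rescaling leaves the precision in `x` intact.
  have hae := blimsup_thickening_mul_ae_eq (volume : Measure (Fin n → ℝ))
    (fun q => ∃ a : ℤ, |(q : ℝ) * x - a| < ψ q) (rationalPoints (Fin n)) hk _ hr
  change ∀ᵐ y : Fin n → ℝ, fiberPoint (d := n + 1) x y ∈ approximable (n + 1) ψ
  filter_upwards [hae.mem_iff] with y hy
  have hlarge : y ∈ blimsup (fun q : ℕ => Metric.thickening (k * (ψ q / q))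
      (rationalPoints (Fin n) q)) atTop (fun q => ∃ a : ℤ, |(q : ℝ) * x - a| < ψ q) := by
    rw [mem_blimsup_atTop_iff]
    refine ((happ (fiberPoint x y)).and_eventually (eventually_ge_atTop 1)).mono ?_
    rintro q ⟨⟨p, hp0, hp⟩, hq⟩
    rw [hzero] at hp0
    refine ⟨⟨p 0, hp0⟩, ?_⟩
    rw [← mul_div_assoc, mem_thickening_rationalPoints hq
      (mul_pos hk ((abs_nonneg _).trans_lt hp0))]
    exact ⟨fun i => p i.succ, fun i => by simpa [hsucc] using hp i.succ⟩
  have hsmall := mem_blimsup_atTop_iff.1 (hy.1 hlarge)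
  have hinf := Nat.frequently_atTop_iff_infinite.1
    (hsmall.and_eventually (eventually_ge_atTop 1))
  refine Set.Infinite.of_image Prod.snd (hinf.mono ?_)
  rintro q ⟨⟨⟨a, ha⟩, hyq⟩, hq⟩
  have hψq : 0 < ψ q := (abs_nonneg _).trans_lt ha
  obtain ⟨p, hp⟩ := (mem_thickening_rationalPoints hq hψq).1 hyq
  refine ⟨(Fin.cons a p, q), ⟨hq, ?_⟩, rfl⟩
  rw [pi_norm_lt_iff hψq]
  intro i
  refine Fin.cases ?_ (fun j => ?_) i
  · simpa [hzero] using ha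
  · simpa [hsucc] using hp j
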